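/- Let $n\ge 0$ and let $f:\{0,1\}^n\to\{0,1\}$ be a Boolean function that is not constant. For an input $x$, let $s(f,x)$ be the number of indices $i$ such that flipping the $i$-th bit of $x$ changes the value of $f$, and let $C(f,x)$ be the minimum of $|P|$ over all partial assignments $c:P\to\{0,1\}$, $P\subseteq\{1,\dots,n\}$, that $x$ satisfies (that is, $x_i=c(i)$ for all $i\in P$) and such that $f$ is constant on the set of all inputs satisfying $c$. For $b\in\{0,1\}$ put $$s_b(f)=\max\{s(f,x): f(x)=b\},\qquad C_b(f)=\max\{C(f,x): f(x)=b\}.$$ Then: 1. if $s_1(f)=1$, then $C_0(f)=s_0(f)$; if $s_1(f)>1$, then $$C_0(f)\le 2^{s_1(f)-1}\left(s_0(f)-\tfrac13\right);$$ 2. symmetrically, if $s_0(f)=1$, then $C_1(f)=s_1(f)$; if $s_0(f)>1$, then $$C_1(f)\le 2^{s_0(f)-1}\left(s_1(f)-\tfrac13\right).$$ -/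

import Mathlib

namespace BooleanComplexity

/-- The input `x^P`, obtained from `x` by flipping every bit whose index lies in `P`. -/
def flip {n : ℕ} (x : Fin n → Bool) (P : Finset (Fin n)) : Fin n → Bool :=
  fun i => if i ∈ P then !(x i) else x i

/-- The sensitivity `s(f, x)` of `f` on the input `x`. -/
def sensitivityAt {n : ℕ} (f : (Fin n → Bool) → Bool) (x : Fin n → Bool) : ℕ :=
  (Finset.univ.filter fun i : Fin n => f x ≠ f (flip x {i})).card

/-- The `b`-sensitivity `s_b(f)`: the maximum of `s(f, x)` over the inputs `x` with `f x = b`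
(it is `0` if there is no such input). -/
def bSensitivity {n : ℕ} (f : (Fin n → Bool) → Bool) (b : Bool) : ℕ :=
  (Finset.univ.filter fun x : Fin n → Bool => f x = b).sup (sensitivityAt f)

/-- The input `x` satisfies the partial assignment `c : P → {0,1}`. -/
def Satisfies {n : ℕ} (x : Fin n → Bool) (P : Finset (Fin n)) (c : P → Bool) : Prop :=
  ∀ i : P, x i = c i

/-- The partial assignment `c : P → {0,1}` is a certificate of `f`: `f` is constant on the
subcube of the inputs that satisfy `c`. -/
def IsCertificate {n : ℕ} (f : (Fin n → Bool) → Bool) (P : Finset (Fin n)) (c : P → Bool) :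
    Prop :=
  ∃ b : Bool, ∀ y : Fin n → Bool, Satisfies y P c → f y = b

/-- The certificate complexity `C(f, x)`: the minimum length `|P|` of a certificate
`c : P → {0,1}` of `f` that `x` satisfies. (The set is non-empty, since `P` may be everything.) -/
noncomputable def certificateAt {n : ℕ} (f : (Fin n → Bool) → Bool) (x : Fin n → Bool) : ℕ :=
  sInf {l : ℕ | ∃ (P : Finset (Fin n)) (c : P → Bool),
    Satisfies x P c ∧ IsCertificate f P c ∧ P.card = l}

/-- The `b`-certificate complexity `C_b(f)`: the maximum of `C(f, x)` over the inputs `x` with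
`f x = b` (it is `0` if there is no such input). -/
noncomputable def bCertificate {n : ℕ} (f : (Fin n → Bool) → Bool) (b : Bool) : ℕ :=
  (Finset.univ.filter fun x : Fin n → Bool => f x = b).sup (certificateAt f)

end BooleanComplexity

/-!
Let `f x = b` and take a minimal certificate of `x`, so that the subcube through `x` with the
remaining coordinates `D` free is a maximal one on which `f` is constant. By maximality, every
direction `i` of the certificate is sensitive at some point of this subcube. The set of these
points, the crossing of `i`, has at most `s - 1` edges leaving it at each of its points, where
`s = s_{1-b}(f)`, because the endpoint across is also sensitive in the direction back. Such a set
has density at least `2 ^ (1 - s)` in the subcube, while each point lies on at most `s_b(f)`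
crossings, which gives `C_b(f) ≤ 2 ^ (s - 1) * s_b(f)`.

For the term `-1/3`: a crossing of density less than `3/2 * 2 ^ (1 - s)` is itself a subcube of
density exactly `2 ^ (1 - s)`, so exactly `s - 1` edges leave it at each point; call it light. At a
full point, where `s_b(f)` light crossings and no others meet, the edges leaving one of these
crossings end at points on fewer than `s_b(f)` crossings, and such a deficient point is adjacent to
at most `s - 1` full points. By double counting there are at most as many full as deficient points,
and counting every light crossing `3/2` times then saves the third.
-/

namespace BooleanComplexity

open Finset

section Hypercube

variable {ι : Type*}

theorem card_filter_apply_add_card_filter_apply_not (V : Finset (ι → Bool)) (i : ι) (b : Bool) :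
    #{x ∈ V | x i = b} + #{x ∈ V | x i = !b} = #V := by
  simp only [Bool.eq_not]
  exact card_filter_add_card_filter_not _

variable [DecidableEq ι]

/-- The neighbour of `x` in direction `i` of the hypercube `ι → Bool`: the special case `x^{i}` of
`flip`, for an arbitrary index type. -/
def flipBit (x : ι → Bool) (i : ι) : ι → Bool :=
  Function.update x i (!x i)

theorem flipBit_apply_self (x : ι → Bool) (i : ι) : flipBit x i i = !x i :=
  Function.update_self ..

theorem flipBit_apply_of_ne (x : ι → Bool) {i j : ι} (h : j ≠ i) : flipBit x i j = x j :=
  Function.update_of_ne h ..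

theorem flipBit_flipBit (x : ι → Bool) (i : ι) : flipBit (flipBit x i) i = x := by
  simp [flipBit]

theorem flipBit_comm (x : ι → Bool) (i j : ι) :
    flipBit (flipBit x i) j = flipBit (flipBit x j) i := by
  funext k
  simp only [flipBit, Function.update_apply]
  grind

theorem flipBit_injective (x : ι → Bool) : Function.Injective (flipBit x) := by
  intro i j h
  by_contra hij
  have := congrFun h i
  simp [flipBit_apply_self, flipBit_apply_of_ne x hij] at this

theorem forall_flipBit_notMem_or_filter_nonempty (V : Finset (ι → Bool)) (i : ι) :
    (∀ x ∈ V, flipBit x i ∉ V) ∨ ∀ b, {x ∈ V | x i = b}.Nonempty := by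
  refine or_iff_not_imp_left.2 fun h b => ?_
  push Not at h
  obtain ⟨x, hx, hxi⟩ := h
  by_cases hb : x i = b
  · exact ⟨x, mem_filter.2 ⟨hx, hb⟩⟩
  · refine ⟨flipBit x i, mem_filter.2 ⟨hxi, ?_⟩⟩
    rw [flipBit_apply_self, Bool.eq_not_of_ne hb, Bool.not_not]

variable [Fintype ι]

/-- The directions in `D` along which the edge of the hypercube at `x` leaves `V`. -/
def exitDirs (V : Finset (ι → Bool)) (D : Finset ι) (x : ι → Bool) : Finset ι :=
  {i ∈ D | flipBit x i ∉ V}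

theorem card_exitDirs_insert {V : Finset (ι → Bool)} {D : Finset ι} {x : ι → Bool} {i : ι}
    (hi : i ∉ D) (hxi : flipBit x i ∉ V) :
    #(exitDirs V (insert i D) x) = #(exitDirs V D x) + 1 := by
  rw [exitDirs, filter_insert, if_pos hxi, card_insert_of_notMem (by simp [hi]), exitDirs]

theorem exitDirs_filter_apply_eq (V : Finset (ι → Bool)) {D : Finset ι} {x : ι → Bool} {i : ι}
    (hi : i ∉ D) : exitDirs {y ∈ V | y i = x i} D x = exitDirs V D x := by
  refine filter_congr fun j hj => ?_
  have hij : i ≠ j := fun h => hi (h ▸ hj)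
  simp [flipBit_apply_of_ne x hij]

theorem card_exitDirs_filter_apply_le {V : Finset (ι → Bool)} {D D' : Finset ι} {i : ι} {r : ℕ}
    (hV : ∀ x ∈ V, #(exitDirs V D' x) ≤ r) (hD : D ⊆ D') (hi : i ∉ D) (b : Bool) :
    ∀ x ∈ {x ∈ V | x i = b}, #(exitDirs {x ∈ V | x i = b} D x) ≤ r := by
  intro x hx
  obtain ⟨hxV, rfl⟩ := mem_filter.1 hx
  rw [exitDirs_filter_apply_eq V hi]
  exact (card_le_card (filter_subset_filter _ hD)).trans (hV x hxV)

theorem exists_card_exitDirs_le_of_forall_flipBit_notMem {V : Finset (ι → Bool)} {D : Finset ι}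
    {i : ι} {r : ℕ} (hne : V.Nonempty) (hV : ∀ x ∈ V, #(exitDirs V (insert i D) x) ≤ r)
    (hi : i ∉ D) (hout : ∀ x ∈ V, flipBit x i ∉ V) :
    ∃ k, r = k + 1 ∧ ∀ x ∈ V, #(exitDirs V D x) ≤ k := by
  have hlt : ∀ x ∈ V, #(exitDirs V D x) + 1 ≤ r := fun x hx =>
    card_exitDirs_insert hi (hout x hx) ▸ hV x hx
  obtain ⟨x, hx⟩ := hne
  exact ⟨r - 1, by have := hlt x hx; omega, fun y hy => Nat.le_sub_one_of_lt (hlt y hy)⟩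

theorem two_pow_card_le_two_pow_mul_card {D : Finset ι} {r : ℕ} {V : Finset (ι → Bool)}
    (hne : V.Nonempty) (hV : ∀ x ∈ V, #(exitDirs V D x) ≤ r) : 2 ^ #D ≤ 2 ^ r * #V := by
  induction D using Finset.induction_on generalizing r V with
  | empty => exact Nat.mul_pos (Nat.two_pow_pos r) hne.card_pos
  | insert i D hi ih =>
    rw [card_insert_of_notMem hi, pow_succ]
    obtain hout | hhalf := forall_flipBit_notMem_or_filter_nonempty V i
    · obtain ⟨k, rfl, hk⟩ := exists_card_exitDirs_le_of_forall_flipBit_notMem hne hV hi hout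
      rw [pow_succ]
      linarith [ih hne hk]
    · have hb (b : Bool) : 2 ^ #D ≤ 2 ^ r * #{x ∈ V | x i = b} :=
        ih (hhalf b) (card_exitDirs_filter_apply_le hV (subset_insert i D) hi b)
      rw [← card_filter_apply_add_card_filter_apply_not V i true]
      linarith [hb true, hb (!true)]

/-- The subcube of the points that agree with `a` outside the set `D` of free coordinates. -/
def subcube (a : ι → Bool) (D : Finset ι) : Finset (ι → Bool) :=
  Fintype.piFinset fun i => if i ∈ D then univ else {a i}

theorem mem_subcube {a x : ι → Bool} {D : Finset ι} :
    x ∈ subcube a D ↔ ∀ i ∉ D, x i = a i := by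
  simp only [subcube, Fintype.mem_piFinset]
  refine forall_congr' fun i => ?_
  by_cases h : i ∈ D <;> simp [h]

theorem subcube_empty (a : ι → Bool) : subcube a ∅ = {a} := by
  simp [subcube]

theorem card_subcube (a : ι → Bool) (D : Finset ι) : #(subcube a D) = 2 ^ #D := by
  simp [subcube, Fintype.card_piFinset, apply_ite Finset.card]

theorem flipBit_mem_subcube_iff {a x : ι → Bool} {D : Finset ι} {i : ι} (hx : x ∈ subcube a D) :
    flipBit x i ∈ subcube a D ↔ i ∈ D := by
  rw [mem_subcube] at hx ⊢
  refine ⟨fun h => ?_, fun hi j hj => ?_⟩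
  · by_contra hi
    simpa [flipBit_apply_self, hx i hi] using h i hi
  · rw [flipBit_apply_of_ne x (by rintro rfl; exact hj hi), hx j hj]

theorem mem_subcube_or_flipBit_mem_subcube {a x : ι → Bool} {D : Finset ι} {i : ι}
    (hx : x ∈ subcube a (insert i D)) : x ∈ subcube a D ∨ flipBit x i ∈ subcube a D := by
  simp only [mem_subcube, mem_insert, not_or] at hx ⊢
  by_cases hi : x i = a i
  · refine .inl fun j hj => ?_
    by_cases hji : j = i
    · rw [hji, hi]
    · exact hx j ⟨hji, hj⟩
  · refine .inr fun j hj => ?_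
    by_cases hji : j = i
    · rw [hji, flipBit_apply_self, ← Bool.eq_not_of_ne (Ne.symm hi)]
    · rw [flipBit_apply_of_ne x hji, hx j ⟨hji, hj⟩]

theorem exitDirs_subcube {a x : ι → Bool} {E : Finset ι} (hx : x ∈ subcube a E) (D : Finset ι) :
    exitDirs (subcube a E) D x = D \ E := by
  ext i
  simp [exitDirs, flipBit_mem_subcube_iff hx]

/-- A point of `V` outside the subcube differs from it in a fixed coordinate; the part of `V` on
that side is disjoint from the subcube and, being a set with few exits one dimension lower, at
least half as large. -/
theorem eq_subcube_or_three_mul_two_pow_le_of_subset {D E : Finset ι} {r : ℕ} {a : ι → Bool}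
    {V : Finset (ι → Bool)} (hV : ∀ x ∈ V, #(exitDirs V D x) ≤ r) (hE : #E + r = #D)
    (hsub : subcube a E ⊆ V) : V = subcube a E ∨ 3 * 2 ^ #D ≤ 2 ^ (r + 1) * #V := by
  refine or_iff_not_imp_left.2 fun hne => ?_
  obtain ⟨v, hvV, hv⟩ : ∃ v ∈ V, v ∉ subcube a E :=
    not_subset.1 fun h => hne (h.antisymm hsub)
  obtain ⟨e, he, hve⟩ : ∃ e, e ∉ E ∧ v e ≠ a e := by simpa [mem_subcube] using hv
  have hside : 2 ^ #(D.erase e) ≤ 2 ^ r * #{x ∈ V | x e = v e} :=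
    two_pow_card_le_two_pow_mul_card ⟨v, by simpa using hvV⟩
      (card_exitDirs_filter_apply_le hV (erase_subset e D) (notMem_erase e D) _)
  have herase : 2 ^ #D ≤ 2 * 2 ^ #(D.erase e) := by
    rw [← pow_succ']
    exact Nat.pow_le_pow_right two_pos (Nat.sub_le_iff_le_add.1 pred_card_le_card_erase)
  have hdisj : Disjoint (subcube a E) {x ∈ V | x e = v e} := by
    refine disjoint_left.2 fun x hx hx' => hve ?_
    rw [← (mem_filter.1 hx').2, mem_subcube.1 hx e he]
  have hcard : #(subcube a E) + #{x ∈ V | x e = v e} ≤ #V := by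
    rw [← card_union_of_disjoint hdisj]
    exact card_le_card (union_subset hsub (filter_subset _ _))
  have hpow : 2 ^ #D = 2 ^ r * #(subcube a E) := by rw [card_subcube, ← pow_add, ← hE, add_comm]
  calc 3 * 2 ^ #D ≤ 2 ^ (r + 1) * (#(subcube a E) + #{x ∈ V | x e = v e}) := by
        rw [pow_succ]; linarith
    _ ≤ 2 ^ (r + 1) * #V := Nat.mul_le_mul_left _ hcard

/-- The points of the half-subcube already have `r` exits, so the direction `i` is not another. -/
theorem subcube_insert_subset {D E : Finset ι} {i : ι} {r : ℕ} {a : ι → Bool} {b : Bool}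
    {V : Finset (ι → Bool)} (hV : ∀ x ∈ V, #(exitDirs V (insert i D) x) ≤ r) (hi : i ∉ D)
    (hED : E ⊆ D) (hE : #E + r = #D) (hhalf : {x ∈ V | x i = b} = subcube a E) :
    subcube a (insert i E) ⊆ V := by
  have hmem : ∀ x ∈ subcube a E, x ∈ V ∧ flipBit x i ∈ V := by
    intro x hx
    obtain ⟨hxV, rfl⟩ := mem_filter.1 (hhalf ▸ hx)
    refine ⟨hxV, by_contra fun hout => ?_⟩
    have hexit : #(exitDirs V D x) = r := by
      rw [← exitDirs_filter_apply_eq V hi, hhalf, exitDirs_subcube hx,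
        card_sdiff_of_subset hED, ← hE, Nat.add_sub_cancel_left]
    have := hV x hxV
    rw [card_exitDirs_insert hi hout, hexit] at this
    omega
  intro x hx
  obtain hx | hx := mem_subcube_or_flipBit_mem_subcube hx
  · exact (hmem x hx).1
  · exact flipBit_flipBit x i ▸ (hmem _ hx).2

theorem eq_subcube_or_three_mul_two_pow_le {D : Finset ι} {r : ℕ} {V : Finset (ι → Bool)}
    (hne : V.Nonempty) (hV : ∀ x ∈ V, #(exitDirs V D x) ≤ r) :
    (∃ a, ∃ E ⊆ D, #E + r = #D ∧ V = subcube a E) ∨ 3 * 2 ^ #D ≤ 2 ^ (r + 1) * #V := by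
  induction D using Finset.induction_on generalizing r V with
  | empty =>
    obtain ⟨a, ha⟩ := hne
    obtain rfl | hr := r.eq_zero_or_pos
    · have hsub : subcube a ∅ ⊆ V := by simpa [subcube_empty] using ha
      exact (eq_subcube_or_three_mul_two_pow_le_of_subset hV rfl hsub).imp_left
        fun h => ⟨a, ∅, Subset.rfl, rfl, h⟩
    · have : 2 ^ 2 ≤ 2 ^ (r + 1) := Nat.pow_le_pow_right two_pos (by omega)
      have : 0 < #V := card_pos.2 ⟨a, ha⟩
      right
      simp only [card_empty, pow_zero]
      nlinarith
  | insert i D hi ih =>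
    obtain hout | hhalf := forall_flipBit_notMem_or_filter_nonempty V i
    · obtain ⟨k, rfl, hk⟩ := exists_card_exitDirs_le_of_forall_flipBit_notMem hne hV hi hout
      rw [card_insert_of_notMem hi]
      refine (ih hne hk).imp ?_ fun h => ?_
      · rintro ⟨a, E, hED, hE, hVE⟩
        exact ⟨a, E, hED.trans (subset_insert i D), by omega, hVE⟩
      · rw [pow_succ, pow_succ 2 (k + 1)]
        linarith
    · have hb (b : Bool) := ih (hhalf b)
        (card_exitDirs_filter_apply_le hV (subset_insert i D) hi b)
      by_cases hcube : ∃ b a, ∃ E ⊆ D, #E + r = #D ∧ {x ∈ V | x i = b} = subcube a E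
      · obtain ⟨b, a, E, hED, hE, hVE⟩ := hcube
        have hE' : #(insert i E) + r = #(insert i D) := by
          rw [card_insert_of_notMem hi, card_insert_of_notMem fun h => hi (hED h)]
          omega
        exact (eq_subcube_or_three_mul_two_pow_le_of_subset hV hE'
          (subcube_insert_subset hV hi hED hE hVE)).imp_left
            fun h => ⟨a, insert i E, insert_subset_insert i hED, hE', h⟩
      · have hheavy (b : Bool) := (hb b).resolve_left fun h => hcube ⟨b, h⟩
        right
        rw [card_insert_of_notMem hi, pow_succ,
          ← card_filter_apply_add_card_filter_apply_not V i true]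
        linarith [hheavy true, hheavy (!true)]

end Hypercube

section Sensitivity

variable {n : ℕ} {f : (Fin n → Bool) → Bool} {b : Bool} {x : Fin n → Bool}

theorem flip_singleton (x : Fin n → Bool) (i : Fin n) : flip x {i} = flipBit x i := by
  funext j
  obtain rfl | h := eq_or_ne j i <;> simp [flip, flipBit, *]

theorem card_le_bSensitivity {T : Finset (Fin n)} (hx : f x = b)
    (hT : ∀ i ∈ T, f (flipBit x i) ≠ b) : #T ≤ bSensitivity f b := by
  have hle : #T ≤ sensitivityAt f x := card_le_card fun i hi =>
    mem_filter.2 ⟨mem_univ i, by rw [flip_singleton, hx]; exact (hT i hi).symm⟩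
  exact hle.trans (le_sup (f := sensitivityAt f) (mem_filter.2 ⟨mem_univ x, hx⟩))

theorem bSensitivity_pos_of_not (h : 0 < bSensitivity f (!b)) : 0 < bSensitivity f b := by
  obtain ⟨x, hx, hpos⟩ := Finset.lt_sup_iff.1 h
  obtain ⟨i, hi⟩ := card_pos.1 hpos
  simp only [mem_filter_univ, flip_singleton] at hx hi
  refine card_le_bSensitivity (x := flipBit x i) (T := {i}) ?_ ?_
  · exact Bool.ne_not.1 (hx ▸ hi.symm)
  · simp [flipBit_flipBit, hx]

theorem sensitivityAt_le_certificateAt (f : (Fin n → Bool) → Bool) (x : Fin n → Bool) :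
    sensitivityAt f x ≤ certificateAt f x := by
  refine le_csInf ⟨_, univ, fun i => x i, fun _ => rfl, ⟨f x, fun y hy => ?_⟩, rfl⟩ ?_
  · exact congrArg f (funext fun i => hy ⟨i, mem_univ i⟩)
  · rintro _ ⟨P, c, hx, ⟨b, hb⟩, rfl⟩
    refine card_le_card fun i hi => by_contra fun hiP => (mem_filter.1 hi).2 ?_
    rw [flip_singleton, hb x hx, hb (flipBit x i) fun j => ?_]
    rw [flipBit_apply_of_ne x (ne_of_mem_of_not_mem j.2 hiP)]
    exact hx j

theorem bSensitivity_le_bCertificate (f : (Fin n → Bool) → Bool) (b : Bool) :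
    bSensitivity f b ≤ bCertificate f b :=
  sup_mono_fun fun x _ => sensitivityAt_le_certificateAt f x

/-- The function `f` is constant on the subcube through `x` with free coordinates `D`, i.e. the
coordinates outside `D` form a certificate of `x`. In a minimal certificate `D` is maximal. -/
def Monochromatic (f : (Fin n → Bool) → Bool) (x : Fin n → Bool) (D : Finset (Fin n)) : Prop :=
  ∀ y ∈ subcube x D, f y = f x

theorem Monochromatic.certificateAt_le {D : Finset (Fin n)} (hD : Monochromatic f x D) :
    certificateAt f x ≤ #Dᶜ :=
  Nat.sInf_le ⟨Dᶜ, fun i => x i, fun _ => rfl,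
    ⟨f x, fun y hy => hD y (mem_subcube.2 fun i hi => hy ⟨i, mem_compl.2 hi⟩)⟩, rfl⟩

theorem exists_maximal_monochromatic (f : (Fin n → Bool) → Bool) (x : Fin n → Bool) :
    ∃ D, Maximal (Monochromatic f x) D := by
  have hempty : Monochromatic f x ∅ := by simp [Monochromatic, subcube_empty]
  obtain ⟨D, -, hD⟩ := (Set.toFinite {D | Monochromatic f x D}).exists_le_maximal hempty
  exact ⟨D, hD⟩

theorem bCertificate_le_of_forall_maximal {N : ℕ}
    (h : ∀ x D, f x = b → Maximal (Monochromatic f x) D → #Dᶜ ≤ N) : bCertificate f b ≤ N := by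
  refine Finset.sup_le fun x hx => ?_
  obtain ⟨D, hD⟩ := exists_maximal_monochromatic f x
  exact hD.prop.certificateAt_le.trans (h x D (mem_filter.1 hx).2 hD)

end Sensitivity

section Crossing

variable {n : ℕ} {f : (Fin n → Bool) → Bool} {x : Fin n → Bool} {D : Finset (Fin n)}

/-- The points of the subcube through `x` with free coordinates `D` whose neighbour in direction
`i` has a value other than `f x`. -/
def crossing (f : (Fin n → Bool) → Bool) (x : Fin n → Bool) (D : Finset (Fin n)) (i : Fin n) :
    Finset (Fin n → Bool) :=
  {y ∈ subcube x D | f (flipBit y i) ≠ f x}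

/-- The directions leaving the subcube with free coordinates `D` in which the neighbour of `y` has
a value other than `f x`; for `y` in the subcube through `x`, those whose crossings contain `y`. -/
def crossingDirs (f : (Fin n → Bool) → Bool) (x : Fin n → Bool) (D : Finset (Fin n))
    (y : Fin n → Bool) : Finset (Fin n) :=
  {i ∈ Dᶜ | f (flipBit y i) ≠ f x}

theorem mem_crossing {i : Fin n} {y : Fin n → Bool} :
    y ∈ crossing f x D i ↔ y ∈ subcube x D ∧ f (flipBit y i) ≠ f x :=
  mem_filter

theorem mem_crossingDirs {i : Fin n} {y : Fin n → Bool} :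
    i ∈ crossingDirs f x D y ↔ i ∉ D ∧ f (flipBit y i) ≠ f x := by
  simp [crossingDirs]

theorem mem_crossing_iff_mem_crossingDirs {i : Fin n} {y : Fin n → Bool} (hi : i ∉ D)
    (hy : y ∈ subcube x D) : y ∈ crossing f x D i ↔ i ∈ crossingDirs f x D y := by
  simp [mem_crossing, mem_crossingDirs, hi, hy]

theorem crossing_nonempty (hD : Maximal (Monochromatic f x) D) {i : Fin n} (hi : i ∉ D) :
    (crossing f x D i).Nonempty := by
  by_contra hempty
  have hconst : ∀ y ∈ subcube x D, f (flipBit y i) = f x := fun y hy =>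
    by_contra fun h => hempty ⟨y, mem_crossing.2 ⟨hy, h⟩⟩
  have hmono : Monochromatic f x (insert i D) := by
    intro y hy
    obtain hy | hy := mem_subcube_or_flipBit_mem_subcube hy
    · exact hD.prop y hy
    · exact flipBit_flipBit y i ▸ hconst _ hy
  exact hi (hD.le_of_ge hmono (subset_insert i D) (mem_insert_self i D))

theorem card_crossingDirs_le (hD : Monochromatic f x D) {y : Fin n → Bool}
    (hy : y ∈ subcube x D) : #(crossingDirs f x D y) ≤ bSensitivity f (f x) :=
  card_le_bSensitivity (hD y hy) fun _ hi => (mem_crossingDirs.1 hi).2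

/-- The endpoint across the crossing is also sensitive in the direction `i` leading back. -/
theorem card_lt_bSensitivity_not_of_mem_crossing (hD : Monochromatic f x D) {i : Fin n}
    {y : Fin n → Bool} (hy : y ∈ crossing f x D i) {T : Finset (Fin n)} (hi : i ∉ T)
    (hT : ∀ j ∈ T, f (flipBit (flipBit y j) i) = f x) : #T < bSensitivity f (!f x) := by
  obtain ⟨hyD, hyi⟩ := mem_crossing.1 hy
  rw [← Nat.succ_le_iff, Nat.succ_eq_add_one, ← card_insert_of_notMem hi]
  refine card_le_bSensitivity (Bool.eq_not_of_ne hyi) fun j hj => Bool.ne_not.2 ?_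
  obtain rfl | hj := mem_insert.1 hj
  · rw [flipBit_flipBit, hD y hyD]
  · rw [flipBit_comm, hT j hj]

theorem apply_flipBit_flipBit_of_mem_exitDirs {i j : Fin n} {y : Fin n → Bool}
    (hy : y ∈ crossing f x D i) (hj : j ∈ exitDirs (crossing f x D i) D y) :
    f (flipBit (flipBit y j) i) = f x := by
  obtain ⟨hjD, hj⟩ := mem_filter.1 hj
  exact by_contra fun h =>
    hj (mem_crossing.2 ⟨(flipBit_mem_subcube_iff (mem_crossing.1 hy).1).2 hjD, h⟩)

theorem notMem_exitDirs {V : Finset (Fin n → Bool)} {y : Fin n → Bool} {i : Fin n} (hi : i ∉ D) :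
    i ∉ exitDirs V D y := fun h => hi (mem_filter.1 h).1

theorem card_exitDirs_crossing_lt (hD : Monochromatic f x D) {i : Fin n} (hi : i ∉ D)
    {y : Fin n → Bool} (hy : y ∈ crossing f x D i) :
    #(exitDirs (crossing f x D i) D y) < bSensitivity f (!f x) :=
  card_lt_bSensitivity_not_of_mem_crossing hD hy (notMem_exitDirs hi)
    fun _ hj => apply_flipBit_flipBit_of_mem_exitDirs hy hj

theorem sum_card_crossing {S : Finset (Fin n)} (hS : S ⊆ Dᶜ) :
    ∑ i ∈ S, #(crossing f x D i) = ∑ y ∈ subcube x D, #(S ∩ crossingDirs f x D y) := by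
  simp only [crossing, crossingDirs, inter_filter, inter_eq_left.2 hS, card_filter]
  exact sum_comm

theorem sum_card_crossing_compl :
    ∑ i ∈ Dᶜ, #(crossing f x D i) = ∑ y ∈ subcube x D, #(crossingDirs f x D y) := by
  rw [sum_card_crossing Subset.rfl]
  simp only [crossingDirs, inter_filter, inter_self]

theorem card_compl_le_two_pow_mul (hD : Maximal (Monochromatic f x) D) :
    #Dᶜ ≤ 2 ^ (bSensitivity f (!f x) - 1) * bSensitivity f (f x) := by
  have hlower : ∀ i ∈ Dᶜ, 2 ^ #D ≤ 2 ^ (bSensitivity f (!f x) - 1) * #(crossing f x D i) := by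
    intro i hi
    have hi := mem_compl.1 hi
    exact two_pow_card_le_two_pow_mul_card (crossing_nonempty hD hi) fun y hy =>
      Nat.le_sub_one_of_lt (card_exitDirs_crossing_lt hD.prop hi hy)
  have hupper : ∑ i ∈ Dᶜ, #(crossing f x D i) ≤ 2 ^ #D * bSensitivity f (f x) := by
    rw [sum_card_crossing_compl, ← card_subcube x D]
    exact sum_le_card_nsmul _ _ _ fun y hy => card_crossingDirs_le hD.prop hy
  refine Nat.le_of_mul_le_mul_right (c := 2 ^ #D) ?_ (Nat.two_pow_pos _)
  calc #Dᶜ * 2 ^ #D ≤ ∑ i ∈ Dᶜ, 2 ^ (bSensitivity f (!f x) - 1) * #(crossing f x D i) :=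
        card_nsmul_le_sum _ _ _ hlower
    _ ≤ 2 ^ (bSensitivity f (!f x) - 1) * (2 ^ #D * bSensitivity f (f x)) := by
        rw [← mul_sum]
        exact Nat.mul_le_mul_left _ hupper
    _ = 2 ^ (bSensitivity f (!f x) - 1) * bSensitivity f (f x) * 2 ^ #D := by ring

end Crossing

section LightCrossing

variable {n : ℕ} {f : (Fin n → Bool) → Bool} {x : Fin n → Bool} {D : Finset (Fin n)}

open Classical in
/-- The directions whose crossing is a subcube of the least size that the sensitivity of `f` on the
value opposite to `f x` permits. -/
noncomputable def lightDirs (f : (Fin n → Bool) → Bool) (x : Fin n → Bool) (D : Finset (Fin n)) :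
    Finset (Fin n) :=
  {i ∈ Dᶜ | ∃ a, ∃ E ⊆ D, #E + bSensitivity f (!f x) = #D + 1 ∧ crossing f x D i = subcube a E}

theorem mem_lightDirs {i : Fin n} :
    i ∈ lightDirs f x D ↔ i ∉ D ∧ ∃ a, ∃ E ⊆ D, #E + bSensitivity f (!f x) = #D + 1 ∧
      crossing f x D i = subcube a E := by
  simp [lightDirs]

theorem lightDirs_subset_compl : lightDirs f x D ⊆ Dᶜ :=
  fun _ hi => mem_compl.2 (mem_lightDirs.1 hi).1

theorem two_pow_mul_card_crossing_of_mem_lightDirs {i : Fin n} (hi : i ∈ lightDirs f x D) :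
    2 ^ bSensitivity f (!f x) * #(crossing f x D i) = 2 * 2 ^ #D := by
  obtain ⟨-, a, E, -, hE, hcross⟩ := mem_lightDirs.1 hi
  rw [hcross, card_subcube, ← pow_add, add_comm, hE, pow_succ']

theorem three_mul_two_pow_le_of_notMem_lightDirs (hD : Maximal (Monochromatic f x) D) {i : Fin n}
    (hi : i ∉ D) (hlight : i ∉ lightDirs f x D) :
    3 * 2 ^ #D ≤ 2 ^ bSensitivity f (!f x) * #(crossing f x D i) := by
  have hexit := fun y hy => card_exitDirs_crossing_lt (y := y) hD.prop hi hy
  obtain ⟨y, hy⟩ := crossing_nonempty hD hi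
  obtain ⟨r, hr⟩ := Nat.exists_eq_add_one.2 ((Nat.zero_le _).trans_lt (hexit y hy))
  rw [hr] at hexit ⊢
  refine (eq_subcube_or_three_mul_two_pow_le ⟨y, hy⟩ fun y hy =>
    Nat.le_of_lt_succ (hexit y hy)).resolve_left ?_
  rintro ⟨a, E, hED, hE, hcross⟩
  exact hlight (mem_lightDirs.2 ⟨hi, a, E, hED, by omega, hcross⟩)

theorem card_exitDirs_add_one_of_mem_lightDirs {i : Fin n} (hi : i ∈ lightDirs f x D)
    {y : Fin n → Bool} (hy : y ∈ crossing f x D i) :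
    #(exitDirs (crossing f x D i) D y) + 1 = bSensitivity f (!f x) := by
  obtain ⟨-, a, E, hED, hE, hcross⟩ := mem_lightDirs.1 hi
  rw [hcross] at hy ⊢
  rw [exitDirs_subcube hy, card_sdiff_of_subset hED]
  have := card_le_card hED
  omega

/-- Across a light crossing the sensitivity is exhausted by the direction back and the exits. -/
theorem apply_flipBit_flipBit_ne_of_mem_lightDirs (hD : Monochromatic f x D) {i k : Fin n}
    (hi : i ∈ lightDirs f x D) {y : Fin n → Bool} (hy : y ∈ crossing f x D i) (hk : k ∉ D)
    (hki : k ≠ i) : f (flipBit (flipBit y k) i) ≠ f x := by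
  intro h
  have hiT : i ∉ insert k (exitDirs (crossing f x D i) D y) := by
    rw [mem_insert, not_or]
    exact ⟨hki.symm, notMem_exitDirs (mem_lightDirs.1 hi).1⟩
  have hlt := card_lt_bSensitivity_not_of_mem_crossing hD hy hiT <|
    (forall_mem_insert ..).2 ⟨h, fun j hj => apply_flipBit_flipBit_of_mem_exitDirs hy hj⟩
  rw [card_insert_of_notMem (notMem_exitDirs hk),
    card_exitDirs_add_one_of_mem_lightDirs hi hy] at hlt
  exact hlt.false

/-- The points of the subcube all of whose sensitive directions are light and which lie on as many
crossings as the sensitivity of `f` on the value `f x` permits. -/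
noncomputable def fullPoints (f : (Fin n → Bool) → Bool) (x : Fin n → Bool)
    (D : Finset (Fin n)) : Finset (Fin n → Bool) :=
  {y ∈ subcube x D | crossingDirs f x D y ⊆ lightDirs f x D ∧
    #(crossingDirs f x D y) = bSensitivity f (f x)}

/-- The points of the subcube that lie on fewer crossings than the sensitivity of `f` on the value
`f x` permits. They compensate for the full points in the counting of light crossings. -/
def deficientPoints (f : (Fin n → Bool) → Bool) (x : Fin n → Bool) (D : Finset (Fin n)) :
    Finset (Fin n → Bool) :=
  {y ∈ subcube x D | #(crossingDirs f x D y) < bSensitivity f (f x)}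

/-- Otherwise the neighbour of `y` across the new crossing would be sensitive in all directions of
`crossingDirs f x D y` and in the direction `e`, one more than allowed. -/
theorem crossingDirs_flipBit_subset (hD : Monochromatic f x D) {y : Fin n → Bool}
    (hy : y ∈ fullPoints f x D) {e : Fin n} (he : e ∈ D) :
    crossingDirs f x D (flipBit y e) ⊆ crossingDirs f x D y := by
  obtain ⟨hyD, hlight, hcard⟩ := mem_filter.1 hy
  intro k hk
  obtain ⟨hkD, hk⟩ := mem_crossingDirs.1 hk
  by_contra hky
  have hfk : f (flipBit y k) = f x := by_contra fun h => hky (mem_crossingDirs.2 ⟨hkD, h⟩)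
  have hle := card_le_bSensitivity (T := insert e (crossingDirs f x D y)) hfk <|
    (forall_mem_insert ..).2 ⟨flipBit_comm y e k ▸ hk, fun i hi =>
      apply_flipBit_flipBit_ne_of_mem_lightDirs hD (hlight hi)
        (mem_crossing.2 ⟨hyD, (mem_crossingDirs.1 hi).2⟩) hkD (ne_of_mem_of_not_mem hi hky).symm⟩
  rw [card_insert_of_notMem fun h => (mem_crossingDirs.1 h).1 he, hcard] at hle
  omega

theorem flipBit_mem_deficientPoints (hD : Monochromatic f x D) {y : Fin n → Bool}
    (hy : y ∈ fullPoints f x D) {i e : Fin n} (hi : i ∈ crossingDirs f x D y)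
    (he : e ∈ exitDirs (crossing f x D i) D y) : flipBit y e ∈ deficientPoints f x D := by
  obtain ⟨hyD, -, hcard⟩ := mem_filter.1 hy
  obtain ⟨heD, hout⟩ := mem_filter.1 he
  have hye : flipBit y e ∈ subcube x D := (flipBit_mem_subcube_iff hyD).2 heD
  refine mem_filter.2 ⟨hye, (card_lt_card ?_).trans_eq hcard⟩
  refine Finset.ssubset_iff_subset_ne.2 ⟨crossingDirs_flipBit_subset hD hy heD, fun h => hout ?_⟩
  exact (mem_crossing_iff_mem_crossingDirs (mem_crossingDirs.1 hi).1 hye).2 (h ▸ hi)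

/-- If `flipBit z e` is full, it lies on a light crossing `k` missing `z`; every other direction
leading from `z` to a full point then is an exit direction of that crossing. -/
theorem card_filter_flipBit_mem_fullPoints_lt (hD : Monochromatic f x D)
    (hs : 0 < bSensitivity f (!f x)) {z : Fin n → Bool} (hz : z ∈ deficientPoints f x D) :
    #{e ∈ D | flipBit z e ∈ fullPoints f x D} < bSensitivity f (!f x) := by
  obtain hempty | ⟨e, he⟩ := {e ∈ D | flipBit z e ∈ fullPoints f x D}.eq_empty_or_nonempty
  · rwa [hempty, card_empty]
  obtain ⟨heD, hfull⟩ := mem_filter.1 he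
  obtain ⟨hzD, hlt⟩ := mem_filter.1 hz
  obtain ⟨hze, hlight, hcard⟩ := mem_filter.1 hfull
  obtain ⟨k, hk, hzk⟩ : ∃ k ∈ crossingDirs f x D (flipBit z e), k ∉ crossingDirs f x D z :=
    not_subset.1 fun h => (hcard ▸ hlt).not_ge (card_le_card h)
  obtain ⟨hkD, a, E, -, -, hcross⟩ := mem_lightDirs.1 (hlight hk)
  have hmem {y} (hy : y ∈ subcube x D) : y ∈ subcube a E ↔ k ∈ crossingDirs f x D y :=
    hcross ▸ mem_crossing_iff_mem_crossingDirs hkD hy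
  have hek : flipBit z e ∈ subcube a E := (hmem hze).2 hk
  rw [← card_exitDirs_add_one_of_mem_lightDirs (hlight hk) (hcross ▸ hek), Nat.lt_succ_iff,
    hcross]
  refine card_le_card fun e' he' => ?_
  obtain ⟨heD', hfull'⟩ := mem_filter.1 he'
  refine mem_filter.2 ⟨heD', fun hboth => hzk ?_⟩
  have heE' : e' ∈ E := (flipBit_mem_subcube_iff hek).1 hboth
  have hk' : k ∈ crossingDirs f x D (flipBit z e') := by
    refine crossingDirs_flipBit_subset hD hfull' heD ?_
    rw [flipBit_comm]
    exact (hmem ((flipBit_mem_subcube_iff hze).2 heD')).1 hboth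
  have hz' := (flipBit_mem_subcube_iff ((hmem (mem_filter.1 hfull').1).2 hk')).2 heE'
  rw [flipBit_flipBit] at hz'
  exact (hmem hzD).1 hz'

theorem card_fullPoints_le (hD : Monochromatic f x D) (hs : 1 < bSensitivity f (!f x)) :
    #(fullPoints f x D) ≤ #(deficientPoints f x D) := by
  classical
  refine Nat.le_of_mul_le_mul_right (card_mul_le_card_mul
    (m := bSensitivity f (!f x) - 1) (n := bSensitivity f (!f x) - 1)
    (fun y z => ∃ e ∈ D, z = flipBit y e) ?_ ?_) (Nat.sub_pos_of_lt hs)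
  · intro y hy
    obtain ⟨hyD, hlight, hcard⟩ := mem_filter.1 hy
    obtain ⟨i, hi⟩ : (crossingDirs f x D y).Nonempty := by
      rw [← card_pos, hcard]
      exact bSensitivity_pos_of_not (zero_lt_one.trans hs)
    have hyi := (mem_crossing_iff_mem_crossingDirs (mem_crossingDirs.1 hi).1 hyD).2 hi
    rw [← card_exitDirs_add_one_of_mem_lightDirs (hlight hi) hyi, Nat.add_sub_cancel,
      ← card_image_of_injective _ (flipBit_injective y)]
    refine card_le_card (image_subset_iff.2 fun e he => (mem_bipartiteAbove _).2 ?_)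
    exact ⟨flipBit_mem_deficientPoints hD hy hi he, e, (mem_filter.1 he).1, rfl⟩
  · intro z hz
    refine le_trans ?_ (Nat.le_sub_one_of_lt
      (card_filter_flipBit_mem_fullPoints_lt hD (zero_lt_one.trans hs) hz))
    rw [← card_image_of_injective _ (flipBit_injective z)]
    refine card_le_card fun y hy => ?_
    obtain ⟨hy, e, he, rfl⟩ := (mem_bipartiteBelow _).1 hy
    refine mem_image.2 ⟨e, mem_filter.2 ⟨he, ?_⟩, flipBit_flipBit y e⟩
    rwa [flipBit_flipBit]

theorem sum_card_crossing_compl_add_le (hD : Monochromatic f x D) :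
    ∑ i ∈ Dᶜ, #(crossing f x D i) + #(deficientPoints f x D) ≤ 2 ^ #D * bSensitivity f (f x) := by
  rw [sum_card_crossing_compl, deficientPoints, card_filter, ← sum_add_distrib, ← card_subcube x D]
  refine sum_le_card_nsmul _ _ _ fun y hy => ?_
  have := card_crossingDirs_le hD hy
  split_ifs <;> omega

theorem sum_card_crossing_lightDirs_add_le (hD : Monochromatic f x D) :
    ∑ i ∈ lightDirs f x D, #(crossing f x D i) + 2 ^ #D ≤
      2 ^ #D * bSensitivity f (f x) + #(fullPoints f x D) := by
  rw [sum_card_crossing lightDirs_subset_compl, fullPoints, card_filter, ← card_subcube x D,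
    card_eq_sum_ones (subcube x D), sum_mul, ← sum_add_distrib, ← sum_add_distrib]
  refine sum_le_sum fun y hy => ?_
  have hle := card_crossingDirs_le hD hy
  have hinter : #(lightDirs f x D ∩ crossingDirs f x D y) ≤ #(crossingDirs f x D y) :=
    card_le_card inter_subset_right
  split_ifs with hfull
  · omega
  · suffices #(lightDirs f x D ∩ crossingDirs f x D y) < bSensitivity f (f x) by omega
    refine (hinter.trans hle).lt_of_ne fun heq => hfull ?_
    have hcard := hle.antisymm (heq ▸ hinter)
    exact ⟨inter_eq_right.1 (eq_of_subset_of_card_le inter_subset_right (by omega)), hcard⟩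

theorem six_mul_card_compl_mul_le (hD : Maximal (Monochromatic f x) D) :
    6 * #Dᶜ * 2 ^ #D ≤ 2 ^ bSensitivity f (!f x) *
      (∑ i ∈ lightDirs f x D, #(crossing f x D i) + 2 * ∑ i ∈ Dᶜ, #(crossing f x D i)) := by
  set L := lightDirs f x D
  have hlight : 2 ^ bSensitivity f (!f x) * ∑ i ∈ L, #(crossing f x D i) = #L * (2 * 2 ^ #D) := by
    rw [mul_sum, sum_congr rfl fun i => two_pow_mul_card_crossing_of_mem_lightDirs, sum_const,
      smul_eq_mul]
  have hheavy : #(Dᶜ \ L) * (3 * 2 ^ #D) ≤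
      2 ^ bSensitivity f (!f x) * ∑ i ∈ Dᶜ \ L, #(crossing f x D i) := by
    rw [mul_sum]
    refine card_nsmul_le_sum _ _ _ fun i hi => ?_
    obtain ⟨hiD, hiL⟩ := mem_sdiff.1 hi
    exact three_mul_two_pow_le_of_notMem_lightDirs hD (mem_compl.1 hiD) hiL
  rw [← sum_sdiff (lightDirs_subset_compl (f := f) (x := x) (D := D)),
    ← card_sdiff_add_card_eq_card (lightDirs_subset_compl (f := f) (x := x) (D := D))]
  linarith

theorem card_compl_le_two_pow_mul_sub (hD : Maximal (Monochromatic f x) D)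
    (hs : 1 < bSensitivity f (!f x)) :
    (#Dᶜ : ℝ) ≤ 2 ^ (bSensitivity f (!f x) - 1) * ((bSensitivity f (f x) : ℝ) - 1 / 3) := by
  have hcount : ∑ i ∈ lightDirs f x D, #(crossing f x D i) + 2 * ∑ i ∈ Dᶜ, #(crossing f x D i) +
      2 ^ #D ≤ 2 ^ #D * (3 * bSensitivity f (f x)) := by
    linarith [sum_card_crossing_lightDirs_add_le hD.prop, sum_card_crossing_compl_add_le hD.prop,
      card_fullPoints_le hD.prop hs]
  have hlower := six_mul_card_compl_mul_le hD
  obtain ⟨r, hr⟩ := Nat.exists_eq_add_one.2 (zero_lt_one.trans hs)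
  have hbound : 3 * #Dᶜ + 2 ^ r ≤ 2 ^ r * (3 * bSensitivity f (f x)) := by
    rw [hr, pow_succ] at hlower
    refine Nat.le_of_mul_le_mul_right (c := 2 ^ #D) ?_ (Nat.two_pow_pos _)
    linarith [Nat.mul_le_mul_left (2 ^ r) hcount]
  have hreal : (3 * #Dᶜ + 2 ^ r : ℝ) ≤ 2 ^ r * (3 * bSensitivity f (f x)) := by
    exact_mod_cast hbound
  rw [hr, Nat.add_sub_cancel]
  linarith

end LightCrossing

section Certificate

variable {n : ℕ} {f : (Fin n → Bool) → Bool} {b : Bool}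

theorem bCertificate_le_two_pow_mul (f : (Fin n → Bool) → Bool) (b : Bool) :
    bCertificate f b ≤ 2 ^ (bSensitivity f (!b) - 1) * bSensitivity f b :=
  bCertificate_le_of_forall_maximal fun _ _ hx hD => hx ▸ card_compl_le_two_pow_mul hD

theorem bCertificate_eq_bSensitivity (hs : bSensitivity f (!b) = 1) :
    bCertificate f b = bSensitivity f b :=
  le_antisymm (by simpa [hs] using bCertificate_le_two_pow_mul f b)
    (bSensitivity_le_bCertificate f b)

theorem bCertificate_le_two_pow_mul_sub (hs : 1 < bSensitivity f (!b)) :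
    (bCertificate f b : ℝ) ≤
      2 ^ (bSensitivity f (!b) - 1) * ((bSensitivity f b : ℝ) - 1 / 3) := by
  have hb : (1 : ℝ) ≤ bSensitivity f b := by
    exact_mod_cast bSensitivity_pos_of_not (zero_lt_one.trans hs)
  refine (Nat.le_floor_iff (mul_nonneg (by positivity) (by linarith))).1 ?_
  refine bCertificate_le_of_forall_maximal fun x D hx hD => Nat.le_floor ?_
  subst hx
  exact card_compl_le_two_pow_mul_sub hD hs

end Certificate

end BooleanComplexity

theorem theorem1 (n : ℕ) (f : (Fin n → Bool) → Bool)
    (hf : ¬ ∃ b : Bool, ∀ x : Fin n → Bool, f x = b) :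
    (BooleanComplexity.bSensitivity f true = 1 →
      BooleanComplexity.bCertificate f false = BooleanComplexity.bSensitivity f false) ∧
    (1 < BooleanComplexity.bSensitivity f true →
      (BooleanComplexity.bCertificate f false : ℝ) ≤
        2 ^ (BooleanComplexity.bSensitivity f true - 1) *
          ((BooleanComplexity.bSensitivity f false : ℝ) - 1 / 3)) ∧
    (BooleanComplexity.bSensitivity f false = 1 →
      BooleanComplexity.bCertificate f true = BooleanComplexity.bSensitivity f true) ∧
    (1 < BooleanComplexity.bSensitivity f false →
      (BooleanComplexity.bCertificate f true : ℝ) ≤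
        2 ^ (BooleanComplexity.bSensitivity f false - 1) *
          ((BooleanComplexity.bSensitivity f true : ℝ) - 1 / 3)) :=
  ⟨BooleanComplexity.bCertificate_eq_bSensitivity (b := false),
    BooleanComplexity.bCertificate_le_two_pow_mul_sub (b := false),
    BooleanComplexity.bCertificate_eq_bSensitivity (b := true),
    BooleanComplexity.bCertificate_le_two_pow_mul_sub (b := true)⟩
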